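/- Let $G_4$ be the graph on $13$ vertices consisting of a cycle whose vertices are, in cyclic order, $$d_0, a_0, a_1, a_2, d_1, d_2, b_0, b_1, b_2, d_3, c_0, c_1, c_2,$$ together with the two chords $d_0d_2$ and $d_1d_3$. Let $H_3$ be the graph obtained from the complete bipartite graph $K_{2,3}$ by attaching a pendant vertex, called a free node, to each of its three 2-valent vertices. Let $M_4$ be the graph obtained from $G_4$ by taking, for each $i\in\{0,1,2\}$, a new copy of $H_3$ and identifying its three free nodes one-to-one with $a_i$, $b_i$, $c_i$. For a finite connected graph $G$, the (minimum) genus $\gamma(G)$ is the least $k$ such that $G$ has a 2-cell embedding in the closed orientable surface $S_k$ of genus $k$. Here a 2-cell embedding is given by a rotation system, that is, a cyclic ordering of the edge-ends at every vertex, and its surface is $S_k$ for the number $k$ with $|V|-|E|+|F|=2-2k$, where $F$ is the set of faces obtained by face tracing. The Betti number is $\beta(G)=|E(G)|-|V(G)|+c(G)$, where $c(G)$ is the number of components. Then $M_4$ is a cubic graph with $28$ vertices, $\beta(M_4)=15$, and $$\gamma(M_4)=4.$$ -/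

import Mathlib

namespace Milgram

/-- A rotation system on a graph: at every vertex, a cyclic ordering of the edge-ends incident
with it.  An edge-end at `v` is a dart with first endpoint `v`, and `next` sends it to its successor
in the cyclic ordering at `v`. -/
structure RotationSystem {V : Type*} (G : SimpleGraph V) where
  next : Equiv.Perm G.Dart
  fst_next : ∀ d : G.Dart, (next d).fst = d.fst
  cyclic : ∀ d d' : G.Dart, d.fst = d'.fst → next.SameCycle d d'

/-- Face tracing: after walking along `d`, continue with the edge-end that follows the reversal
of `d` in the cyclic ordering at the head of `d`. -/
def RotationSystem.faceNext {V : Type*} {G : SimpleGraph V} (R : RotationSystem G) :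
    Equiv.Perm G.Dart :=
  (Function.Involutive.toPerm SimpleGraph.Dart.symm SimpleGraph.Dart.symm_involutive).trans R.next

/-- The number of faces: the closed walks produced by face tracing, and one face for each
isolated vertex (so that the one-vertex graph on the sphere has one face). -/
noncomputable def RotationSystem.numFaces {V : Type*} {G : SimpleGraph V}
    (R : RotationSystem G) : ℕ :=
  Nat.card (Quotient (Equiv.Perm.SameCycle.setoid R.faceNext)) +
    Nat.card {v : V // ∀ w, ¬ G.Adj v w}

/-- The finite graph `G` has a 2-cell embedding in the closed orientable surface `S_k`: it is
connected and has a rotation system with `|V| - |E| + |F| = 2 - 2k`. -/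
def EmbedsIn {V : Type*} (G : SimpleGraph V) (k : ℕ) : Prop :=
  G.Connected ∧ ∃ R : RotationSystem G,
    (Nat.card V : ℤ) - Nat.card G.edgeSet + R.numFaces = 2 - 2 * (k : ℤ)

/-- The (minimum, orientable) genus of the finite connected graph `G` is `k`. -/
def HasGenus {V : Type*} (G : SimpleGraph V) (k : ℕ) : Prop :=
  IsLeast {j : ℕ | EmbedsIn G j} k

/-- The Betti number `|E| - |V| + c(G)` of a finite graph. -/
noncomputable def bettiNumber {V : Type*} (G : SimpleGraph V) : ℤ :=
  (Nat.card G.edgeSet : ℤ) - Nat.card V + Nat.card G.ConnectedComponent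

/-- The five vertices of `H_3` (the graph `K_{2,3}` with a pendant vertex attached to each 2-valent
vertex) that are not free nodes: the parts `Fin 2` and `Fin 3` of `K_{2,3}`.  The free nodes
are the pendant vertices at the three vertices of the part `Fin 3`. -/
abbrev H3Inner : Type := Fin 2 ⊕ Fin 3

/-- The vertices of a scaffolded graph: those of the base graph, and for each of the `n` triples
the five vertices of a copy of `H_3` that are not free nodes. -/
abbrev ScaffoldVertex (V : Type*) (n : ℕ) : Type _ := V ⊕ (Fin n × H3Inner)

/-- Adjacency in the scaffolded graph. -/
def ScaffoldAdj {V : Type*} (G : SimpleGraph V) {n : ℕ} (T : Fin n → Fin 3 → V) :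
    ScaffoldVertex V n → ScaffoldVertex V n → Prop
  | .inl u, .inl v => G.Adj u v
  | .inl u, .inr (i, .inr j) => u = T i j
  | .inr (i, .inr j), .inl u => u = T i j
  | .inr (i, .inl _), .inr (i', .inr _) => i = i'
  | .inr (i, .inr _), .inr (i', .inl _) => i = i'
  | _, _ => False

/-- The scaffolded graph `H(G, T)`: for each triple `T i`, the three free nodes of the `i`-th copy
of `H_3` are identified with `T i 0`, `T i 1`, `T i 2`. -/
def scaffold {V : Type*} (G : SimpleGraph V) {n : ℕ} (T : Fin n → Fin 3 → V) :
    SimpleGraph (ScaffoldVertex V n) where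
  Adj := ScaffoldAdj G T
  symm := ⟨by
    rintro (u | ⟨i, a | b⟩) (v | ⟨i', a' | b'⟩) h <;> simp only [ScaffoldAdj] at h ⊢
    · exact h.symm
    · exact h
    · exact h.symm
    · exact h
    · exact h.symm⟩
  loopless := ⟨by
    rintro (u | ⟨i, a | b⟩) h <;> simp [ScaffoldAdj] at h⟩

instance {V : Type*} [DecidableEq V] (G : SimpleGraph V) [DecidableRel G.Adj] {n : ℕ}
    (T : Fin n → Fin 3 → V) : DecidableRel (scaffold G T).Adj
  | .inl u, .inl v => inferInstanceAs (Decidable (G.Adj u v))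
  | .inl u, .inr (i, .inr j) => inferInstanceAs (Decidable (u = T i j))
  | .inr (i, .inr j), .inl u => inferInstanceAs (Decidable (u = T i j))
  | .inr (i, .inl _), .inr (i', .inr _) => inferInstanceAs (Decidable (i = i'))
  | .inr (i, .inr _), .inr (i', .inl _) => inferInstanceAs (Decidable (i = i'))
  | .inl _, .inr (_, .inl _) => inferInstanceAs (Decidable False)
  | .inr (_, .inl _), .inl _ => inferInstanceAs (Decidable False)
  | .inr (_, .inl _), .inr (_, .inl _) => inferInstanceAs (Decidable False)
  | .inr (_, .inr _), .inr (_, .inr _) => inferInstanceAs (Decidable False)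

/-- The base graph `G_4`: a cycle whose 13 vertices are, in cyclic order,
`d₀, a₀, a₁, a₂, d₁, d₂, b₀, b₁, b₂, d₃, c₀, c₁, c₂` (numbered `0` to `12`), with
the two overlapping chords `d₀d₂` and `d₁d₃`. -/
abbrev G4 : SimpleGraph (Fin 13) :=
  SimpleGraph.fromRel fun u v => v = u + 1 ∨ (u = 0 ∧ v = 5) ∨ (u = 4 ∧ v = 9)

/-- The three triples `{aᵢ, bᵢ, cᵢ}`, `i = 0, 1, 2`, of 2-valent vertices of `G_4`. -/
def T3 : Fin 3 → Fin 3 → Fin 13 :=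
  ![![1, 6, 10], ![2, 7, 11], ![3, 8, 12]]

/-- The graph `M_4 = H(G_4, T_3)`. -/
abbrev M4 : SimpleGraph (ScaffoldVertex (Fin 13) 3) := scaffold G4 T3

end Milgram

namespace Milgram

open Equiv Equiv.Perm

section CycleCount

variable {α β : Type*}

/-- The number of cycles of a permutation, fixed points included. -/
noncomputable def cycleCount (π : Perm α) : ℕ :=
  Nat.card (Quotient (SameCycle.setoid π))

theorem SameCycle.rel_of_forall (s : Setoid α) {π : Perm α} (h : ∀ x, s x (π x)) {x y : α}
    (hxy : π.SameCycle x y) : s x y := by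
  have hpow : ∀ (n : ℕ) (z : α), s z ((π ^ n) z) := by
    intro n
    induction n with
    | zero => intro z; exact s.refl z
    | succ n ih => intro z; rw [pow_succ', Perm.mul_apply]; exact s.trans (ih z) (h _)
  obtain ⟨i, hi⟩ := hxy
  obtain ⟨n, rfl | rfl⟩ := i.eq_nat_or_neg
  · rw [← hi, zpow_natCast]; exact hpow n x
  · have := hpow n y
    rw [← hi, zpow_neg, zpow_natCast, ← Perm.mul_apply, mul_inv_cancel, Perm.one_apply] at this
    rw [← hi, zpow_neg, zpow_natCast]
    exact s.symm this

theorem cycleCount_le_card [Finite α] (π : Perm α) : cycleCount π ≤ Nat.card α :=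
  Nat.card_le_card_of_surjective _ Quotient.mk_surjective

theorem cycleCount_permCongr (e : α ≃ β) (π : Perm α) :
    cycleCount (e.permCongr π) = cycleCount π := by
  refine (Nat.card_congr (Quotient.congr e fun x y => ?_)).symm
  constructor
  · intro h
    refine SameCycle.rel_of_forall ((SameCycle.setoid (e.permCongr π)).comap e) (fun z => ?_) h
    exact ⟨1, by simp⟩
  · intro h
    have := SameCycle.rel_of_forall ((SameCycle.setoid π).comap e.symm)
      (π := e.permCongr π) (fun z => ⟨1, by simp⟩) h
    have h' : π.SameCycle (e.symm (e x)) (e.symm (e y)) := this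
    rw [e.symm_apply_apply, e.symm_apply_apply] at h'
    exact h'

/-- The setoid obtained by merging the classes of `a` and `b`. -/
def mergeSetoid (s : Setoid α) (a b : α) : Setoid α where
  r x y := s x y ∨ ((s x a ∨ s x b) ∧ (s y a ∨ s y b))
  iseqv := by
    refine ⟨fun x => Or.inl (s.refl x), ?_, ?_⟩
    · rintro x y (h | ⟨h, h'⟩)
      · exact Or.inl (s.symm h)
      · exact Or.inr ⟨h', h⟩
    · rintro x y z (h | ⟨h, h'⟩) (k | ⟨k, k'⟩)
      · exact Or.inl (s.trans h k)
      · exact Or.inr ⟨k.imp (s.trans h) (s.trans h), k'⟩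
      · exact Or.inr ⟨h, h'.imp (s.trans (s.symm k)) (s.trans (s.symm k))⟩
      · exact Or.inr ⟨h, k'⟩

theorem card_quotient_le_mergeSetoid [Finite α] (s : Setoid α) (a b : α) :
    Nat.card (Quotient s) ≤ Nat.card (Quotient (mergeSetoid s a b)) + 1 := by
  classical
  rw [← Finite.card_option]
  let p : Quotient s → Quotient (mergeSetoid s a b) :=
    Quotient.map' id fun _ _ h => Or.inl h
  let f : Quotient s → Option (Quotient (mergeSetoid s a b)) := fun q =>
    if q = Quotient.mk s a then none else some (p q)
  refine Nat.card_le_card_of_injective f ?_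
  intro q q'
  refine Quotient.inductionOn₂ q q' fun x y => ?_
  intro h
  simp only [f] at h
  split_ifs at h with h₁ h₂ h₂
  · rw [h₁, h₂]
  · have h' : (mergeSetoid s a b) x y := Quotient.exact (Option.some.inj h)
    apply Quotient.sound
    have hx : ¬ s x a := fun h => h₁ (Quotient.sound h)
    have hy : ¬ s y a := fun h => h₂ (Quotient.sound h)
    rcases h' with h' | ⟨h₃ | h₃, h₄ | h₄⟩
    · exact h'
    · exact absurd h₃ hx
    · exact absurd h₃ hx
    · exact absurd h₄ hy
    · exact s.trans h₃ (s.symm h₄)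

theorem cycleCount_swap_mul_le [Finite α] [DecidableEq α] (π : Perm α) (a b : α) :
    cycleCount (swap a b * π) ≤ cycleCount π + 1 := by
  let s := SameCycle.setoid (swap a b * π)
  have key : ∀ x, mergeSetoid s a b x (π x) := by
    intro x
    have hx : s x (swap a b (π x)) := ⟨1, by simp⟩
    by_cases ha : π x = a
    · rw [ha, swap_apply_left] at hx
      exact Or.inr ⟨Or.inr hx, Or.inl (ha ▸ s.refl _)⟩
    by_cases hb : π x = b
    · rw [hb, swap_apply_right] at hx
      exact Or.inr ⟨Or.inl hx, Or.inr (hb ▸ s.refl _)⟩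
    · rw [swap_apply_of_ne_of_ne ha hb] at hx
      exact Or.inl hx
  refine (card_quotient_le_mergeSetoid s a b).trans (Nat.add_le_add_right ?_ 1)
  refine Nat.card_le_card_of_surjective
    (Quotient.map' id fun x y h => SameCycle.rel_of_forall _ key h) ?_
  intro q
  refine Quotient.inductionOn q fun x => ⟨Quotient.mk _ x, rfl⟩

/-- Cutting a point out of its cycle creates one more cycle. -/
theorem cycleCount_add_one_le [Finite α] [DecidableEq α] (π : Perm α) {x : α} (hx : π x ≠ x) :
    cycleCount π + 1 ≤ cycleCount (swap x (π x) * π) := by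
  have hfix : (swap x (π x) * π) x = x := by simp
  have key : ∀ y, (SameCycle.setoid π) y ((swap x (π x) * π) y) := by
    intro y
    change π.SameCycle y (swap x (π x) (π y))
    by_cases h₁ : π y = x
    · rw [h₁, swap_apply_left]
      exact ⟨2, by simp [pow_two, h₁, zpow_ofNat]⟩
    by_cases h₂ : y = x
    · rw [h₂, swap_apply_right]
    · rw [swap_apply_of_ne_of_ne h₁ (fun h => h₂ (π.injective h))]
      exact ⟨1, by simp⟩
  have hsame : ∀ y z, (swap x (π x) * π).SameCycle y z → (y = x ↔ z = x) := by
    intro y z h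
    constructor
    · rintro rfl; exact (h.eq_of_left hfix).symm
    · rintro rfl; exact h.eq_of_right hfix
  unfold cycleCount
  rw [← Finite.card_option]
  let f : Quotient (SameCycle.setoid (swap x (π x) * π)) →
      Option (Quotient (SameCycle.setoid π)) :=
    Quotient.lift (fun y => if y = x then none else some (Quotient.mk _ y)) (by
      intro y z h
      have hyz := hsame y z h
      by_cases hy : y = x
      · simp [hy, hyz.1 hy]
      · rw [if_neg hy, if_neg (fun h => hy (hyz.2 h))]
        exact congrArg some (Quotient.sound (SameCycle.rel_of_forall _ key h)))
  refine Nat.card_le_card_of_surjective f ?_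
  rintro (_ | q)
  · exact ⟨Quotient.mk _ x, by simp [f]⟩
  · refine Quotient.inductionOn q fun y => ?_
    by_cases hy : y = x
    · refine ⟨Quotient.mk _ (π x), ?_⟩
      simp only [f, Quotient.lift_mk, if_neg hx]
      refine congrArg some (Quotient.sound ?_)
      rw [hy]
      exact SameCycle.symm ⟨1, by simp⟩
    · exact ⟨Quotient.mk _ y, by simp [f, hy]⟩

theorem cycleCount_mul_add_one_le [Finite α] [DecidableEq α] (ψ φ : Perm α) {x : α}
    (hψ : ψ x = x) (hφ : φ x ≠ x) :
    cycleCount (ψ * φ) + 1 ≤ cycleCount (ψ * (swap x (φ x) * φ)) := by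
  have hx : (ψ * φ) x ≠ x := by
    rw [Perm.mul_apply]
    intro h
    exact hφ (ψ.injective (h.trans hψ.symm))
  have := cycleCount_add_one_le (ψ * φ) hx
  rwa [← mul_assoc, mul_swap_eq_swap_mul, hψ, mul_assoc]

theorem cycleCount_mul_le_of_agree [Fintype α] [DecidableEq α] (ψ φ φ' : Perm α) (s : Finset α)
    (hs : s.card ≤ 2) (h : ∀ x ∉ s, φ x = φ' x) :
    cycleCount (ψ * φ) ≤ cycleCount (ψ * φ') + 1 := by
  have hsupp : (φ'⁻¹ * φ).support ⊆ s := by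
    intro x hx
    by_contra hxs
    rw [mem_support] at hx
    exact hx (by rw [Perm.mul_apply, h x hxs, ← Perm.mul_apply, inv_mul_cancel, Perm.one_apply])
  have hcard := (Finset.card_le_card hsupp).trans hs
  have hφ : φ = φ' * (φ'⁻¹ * φ) := by group
  rcases Nat.lt_or_ge (φ'⁻¹ * φ).support.card 2 with h2 | h2
  · have : (φ'⁻¹ * φ) = 1 := by
      rw [← card_support_le_one]; omega
    rw [hφ, this, mul_one]; omega
  · obtain ⟨a, b, -, hab⟩ := card_support_eq_two.1 (le_antisymm hcard h2)
    rw [hφ, hab, ← mul_assoc, mul_swap_eq_swap_mul]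
    exact cycleCount_swap_mul_le _ _ _

end CycleCount

section FaceSearch

/-- The value at `x` of the function that is given by the association list `l`, with default
values given by `σ`. -/
def lookupD (σ : ℕ → ℕ) : List (ℕ × ℕ) → ℕ → ℕ
  | [], x => σ x
  | p :: l, x => bif Nat.beq p.1 x then p.2 else lookupD σ l x

/-- Make the default value at `z` explicit, unless it is explicit already or `z < j`. -/
def addEntry (σ : ℕ → ℕ) (j z : ℕ) (l : List (ℕ × ℕ)) : List (ℕ × ℕ) :=
  bif Nat.blt z j || l.any (fun p => Nat.beq p.1 z) then l else (z, σ z) :: l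

/-- Turn the block `{3 * v, 3 * v + 1, 3 * v + 2}` cyclically by `r` places. -/
def turn (v r y : ℕ) : ℕ :=
  bif Nat.beq (y / 3) v then 3 * v + (y + r) % 3 else y

/-- Cut `x` out of its cycle and forget it; count it if it is a fixed point. -/
def bypass (σ : ℕ → ℕ) (x : ℕ) (s : List (ℕ × ℕ) × ℕ) : List (ℕ × ℕ) × ℕ :=
  bif Nat.beq (lookupD σ s.1 x) x then (s.1.filter (fun p => ! Nat.beq p.1 x), s.2 + 1)
  else ((s.1.filter (fun p => ! Nat.beq p.1 x)).map
    (fun p => (p.1, bif Nat.beq p.2 x then lookupD σ s.1 x else p.2)), s.2)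

/-- Process the block `v`, turning it by `r` places. -/
def processBlock (σ : ℕ → ℕ) (v r : ℕ) (s : List (ℕ × ℕ) × ℕ) : List (ℕ × ℕ) × ℕ :=
  bypass σ (3 * v + 2) (bypass σ (3 * v + 1) (bypass σ (3 * v)
    ((addEntry σ (3 * v) (σ (3 * v + 2)) (addEntry σ (3 * v) (σ (3 * v + 1))
      (addEntry σ (3 * v) (σ (3 * v)) s.1))).map (fun p => (p.1, turn v r p.2)), s.2)))

/-- The two lists have the same keys, and at most `m` entries differ. -/
def nearBy : ℕ → List (ℕ × ℕ) → List (ℕ × ℕ) → Bool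
  | _, [], [] => true
  | _, [], _ :: _ => false
  | _, _ :: _, [] => false
  | m, p :: l, q :: l' =>
    Nat.beq p.1 q.1 && bif Nat.beq p.2 q.2 then nearBy m l l'
      else match m with
        | 0 => false
        | m + 1 => nearBy m l l'

/-- The state `t` can be discarded in the presence of the state `s`. -/
def dominates (s t : List (ℕ × ℕ) × ℕ) : Bool :=
  bif Nat.ble t.2 s.2 then nearBy (bif Nat.beq t.2 s.2 then 0 else 2) s.1 t.1 else false

/-- Discard dominated states, going through the states by decreasing count. -/
def prune (B : ℕ) (L : List (List (ℕ × ℕ) × ℕ)) : List (List (ℕ × ℕ) × ℕ) :=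
  (List.range (B + 1)).foldr
    (fun c K => (L.filter fun t => Nat.beq t.2 c).foldr
      (fun t K => bif K.any (fun s => dominates s t) then K else t :: K) K)
    (L.filter fun t => Nat.blt B t.2)

/-- `f n`, arranged so that evaluation by unfolding computes `n` first. -/
def withNat {α : Type*} (n : ℕ) (f : ℕ → α) : α :=
  match n with
  | 0 => f 0
  | m + 1 => f (Nat.succ m)

/-- `f l`, arranged so that evaluation by unfolding computes the entries of `l` first. -/
def withEntries {α : Type*} : List (ℕ × ℕ) → (List (ℕ × ℕ) → α) → α
  | [], f => f []
  | p :: l, f => withNat p.1 fun a => withNat p.2 fun b => withEntries l fun l' => f ((a, b) :: l')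

/-- `f L`, arranged so that evaluation by unfolding computes the states in `L` first. -/
def withStates {α : Type*} : List (List (ℕ × ℕ) × ℕ) → (List (List (ℕ × ℕ) × ℕ) → α) → α
  | [], f => f []
  | s :: L, f => withEntries s.1 fun l => withNat s.2 fun n => withStates L fun L' =>
      f ((l, n) :: L')

/-- Process `k` blocks starting with the block `v`, and check that no count exceeds `B`. -/
def searchBound (σ : ℕ → ℕ) (B : ℕ) : ℕ → ℕ → List (List (ℕ × ℕ) × ℕ) → Bool
  | 0, _, L => L.all (fun s => Nat.ble s.2 B)
  | k + 1, v, L =>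
    withStates (L.flatMap fun s => [processBlock σ v 1 s, processBlock σ v 2 s]) fun L' =>
      withStates (prune B L') (searchBound σ B k (v + 1))

variable {σ : ℕ → ℕ}

theorem withNat_eq {α : Type*} (n : ℕ) (f : ℕ → α) : withNat n f = f n := by
  cases n <;> rfl

theorem withEntries_eq {α : Type*} (l : List (ℕ × ℕ)) (f : List (ℕ × ℕ) → α) :
    withEntries l f = f l := by
  induction l generalizing f with
  | nil => rfl
  | cons p l ih => simp [withEntries, withNat_eq, ih]

theorem withStates_eq {α : Type*} (L : List (List (ℕ × ℕ) × ℕ))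
    (f : List (List (ℕ × ℕ) × ℕ) → α) : withStates L f = f L := by
  induction L generalizing f with
  | nil => rfl
  | cons p l ih => simp [withStates, withNat_eq, withEntries_eq, ih]

theorem nat_beq_eq_decide (a b : ℕ) : Nat.beq a b = decide (a = b) := by
  rw [Bool.eq_iff_iff]; simp

theorem lookupD_cons (p : ℕ × ℕ) (l : List (ℕ × ℕ)) (x : ℕ) :
    lookupD σ (p :: l) x = if p.1 = x then p.2 else lookupD σ l x := by
  simp [lookupD, nat_beq_eq_decide, cond_eq_ite]

theorem lookupD_of_forall_ne {l : List (ℕ × ℕ)} {x : ℕ} (h : ∀ p ∈ l, p.1 ≠ x) :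
    lookupD σ l x = σ x := by
  induction l with
  | nil => rfl
  | cons p l ih =>
    rw [lookupD_cons, if_neg (h p (by simp)), ih fun q hq => h q (by simp [hq])]

theorem lookupD_map_of_mem (g : ℕ → ℕ) {l : List (ℕ × ℕ)} {x : ℕ} (h : ∃ p ∈ l, p.1 = x) :
    lookupD σ (l.map fun p => (p.1, g p.2)) x = g (lookupD σ l x) := by
  induction l with
  | nil => simp at h
  | cons p l ih =>
    rw [List.map_cons, lookupD_cons, lookupD_cons]
    by_cases hp : p.1 = x
    · simp [hp]
    · rw [if_neg hp, if_neg hp, ih]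
      simpa [hp] using h

theorem lookupD_map_of_forall_ne (g : ℕ → ℕ) {l : List (ℕ × ℕ)} {x : ℕ} (h : ∀ p ∈ l, p.1 ≠ x) :
    lookupD σ (l.map fun p => (p.1, g p.2)) x = lookupD σ l x := by
  rw [lookupD_of_forall_ne h, lookupD_of_forall_ne]
  intro p hp
  obtain ⟨q, hq, rfl⟩ := List.mem_map.1 hp
  exact h q hq

theorem lookupD_filter_ne (l : List (ℕ × ℕ)) {x z : ℕ} (h : x ≠ z) :
    lookupD σ (l.filter fun p => ! Nat.beq p.1 z) x = lookupD σ l x := by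
  induction l with
  | nil => rfl
  | cons p l ih =>
    by_cases hp : p.1 = z
    · rw [List.filter_cons_of_neg (by simp [hp]), ih, lookupD_cons,
        if_neg (by rw [hp]; exact h.symm)]
    · rw [List.filter_cons_of_pos (by simp [nat_beq_eq_decide, hp]), lookupD_cons, lookupD_cons, ih]

theorem addEntry_eq (j z : ℕ) (l : List (ℕ × ℕ)) :
    addEntry σ j z l = if z < j ∨ ∃ p ∈ l, p.1 = z then l else (z, σ z) :: l := by
  have : (Nat.blt z j || l.any fun p => Nat.beq p.1 z) = decide (z < j ∨ ∃ p ∈ l, p.1 = z) := by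
    rw [Bool.eq_iff_iff]
    simp [Nat.blt]
  simp only [addEntry, this, cond_eq_ite, decide_eq_true_eq]

theorem lookupD_addEntry (j z : ℕ) (l : List (ℕ × ℕ)) (x : ℕ) :
    lookupD σ (addEntry σ j z l) x = lookupD σ l x := by
  rw [addEntry_eq]
  split_ifs with h
  · rfl
  · rw [lookupD_cons]
    split_ifs with hx
    · subst hx
      refine (lookupD_of_forall_ne fun p hp hpz => h (Or.inr ⟨p, hp, hpz⟩)).symm
    · rfl

theorem exists_mem_addEntry_of_exists {j z y : ℕ} {l : List (ℕ × ℕ)} (h : ∃ p ∈ l, p.1 = y) :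
    ∃ p ∈ addEntry σ j z l, p.1 = y := by
  obtain ⟨p, hp, hy⟩ := h
  refine ⟨p, ?_, hy⟩
  rw [addEntry_eq]
  split_ifs <;> simp [hp]

theorem exists_mem_addEntry_self {j z : ℕ} (h : j ≤ z) (l : List (ℕ × ℕ)) :
    ∃ p ∈ addEntry σ j z l, p.1 = z := by
  by_cases h' : ∃ p ∈ l, p.1 = z
  · exact exists_mem_addEntry_of_exists h'
  · rw [addEntry_eq, if_neg (not_or.2 ⟨by omega, h'⟩)]
    exact ⟨(z, σ z), by simp⟩

/-- The permutation `φ` fixes the points below `j`, and is given by `l` on the others. -/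
def Represents (σ : ℕ → ℕ) (j : ℕ) (l : List (ℕ × ℕ)) (φ : Perm (Fin 84)) : Prop :=
  ∀ x : Fin 84, (x.val < j → φ x = x) ∧ (j ≤ x.val → (φ x).val = lookupD σ l x.val)

/-- All points not below `j` that `φ` maps to the block `v` are keys of `l`. -/
def KeysCover (v j : ℕ) (l : List (ℕ × ℕ)) (φ : Perm (Fin 84)) : Prop :=
  ∀ z : Fin 84, j ≤ z.val → (φ z).val / 3 = v → ∃ p ∈ l, p.1 = z.val

theorem bypass_sound {v : ℕ} {j : Fin 84} (hj : j.val / 3 = v) {l : List (ℕ × ℕ)} {n : ℕ}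
    {ψ φ : Perm (Fin 84)} (hψ : ψ j = j) (hr : Represents σ j l φ) (hk : KeysCover v j l φ) :
    ∃ φ' : Perm (Fin 84), Represents σ (j.val + 1) (bypass σ j (l, n)).1 φ' ∧
      KeysCover v (j.val + 1) (bypass σ j (l, n)).1 φ' ∧
      n + cycleCount (ψ * φ) + 1 ≤ (bypass σ j (l, n)).2 + cycleCount (ψ * φ') := by
  have hval := (hr j).2 le_rfl
  by_cases h : φ j = j
  · have hb : bypass σ j (l, n) = (l.filter (fun p => ! Nat.beq p.1 j), n + 1) := by
      have : lookupD σ l j = j := by rw [← hval, h]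
      simp [bypass, this]
    rw [hb]
    refine ⟨φ, fun x => ⟨fun hx => ?_, fun hx => ?_⟩, fun z hz hz' => ?_, by simp⟩
    · rcases Nat.lt_succ_iff_lt_or_eq.1 hx with hx | hx
      · exact (hr x).1 hx
      · rw [Fin.ext hx, h]
    · rw [lookupD_filter_ne _ (by omega)]
      exact (hr x).2 (by omega)
    · obtain ⟨p, hp, hpz⟩ := hk z (by omega) hz'
      exact ⟨p, by simp [hp, nat_beq_eq_decide]; omega, hpz⟩
  · have hne : (φ j).val ≠ j.val := fun h' => h (Fin.ext h')
    obtain ⟨g, hg, hb⟩ : ∃ g : ℕ → ℕ, (∀ y, g y = if y = j.val then (φ j).val else y) ∧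
        bypass σ j (l, n) =
          ((l.filter (fun p => ! Nat.beq p.1 j)).map (fun p => (p.1, g p.2)), n) :=
      ⟨_, fun _ => rfl, by simp [bypass, ← hval, nat_beq_eq_decide, hne, cond_eq_ite]⟩
    have hφj : ∀ z, φ z = φ j → z = j := fun z hz => φ.injective hz
    have hkey : ∀ z : Fin 84, j.val + 1 ≤ z.val → (φ z).val / 3 = v →
        ∃ p ∈ l.filter (fun p => ! Nat.beq p.1 j), p.1 = z.val := by
      intro z hz hz'
      obtain ⟨p, hp, hpz⟩ := hk z (by omega) hz'
      exact ⟨p, by simp [hp, nat_beq_eq_decide]; omega, hpz⟩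
    rw [hb]
    dsimp only
    refine ⟨swap j (φ j) * φ, fun x => ⟨fun hx => ?_, fun hx => ?_⟩, fun z hz hz' => ?_, ?_⟩
    · rcases Nat.lt_succ_iff_lt_or_eq.1 hx with hx | hx
      · have hxj : x ≠ j := by rintro rfl; exact lt_irrefl _ hx
        rw [Perm.mul_apply, (hr x).1 hx, swap_apply_of_ne_of_ne hxj]
        intro h'
        exact hxj (hφj x (((hr x).1 hx).trans h'))
      · rw [Fin.ext hx]; simp
    · have hxj : x ≠ j := by rintro rfl; omega
      have hx' := (hr x).2 (by omega)
      by_cases hφ : φ x = j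
      · rw [lookupD_map_of_mem _ (hkey x hx (by rw [hφ, hj])), lookupD_filter_ne _ (by omega),
          ← hx', hφ, Perm.mul_apply, hφ, swap_apply_left, hg, if_pos rfl]
      · have hφ' : (φ x).val ≠ j.val := fun h' => hφ (Fin.ext h')
        rw [Perm.mul_apply, swap_apply_of_ne_of_ne hφ fun h' => hxj (hφj x h')]
        by_cases hm : ∃ p ∈ l.filter (fun p => ! Nat.beq p.1 j), p.1 = x.val
        · rw [lookupD_map_of_mem _ hm, lookupD_filter_ne _ (by omega), ← hx', hg, if_neg hφ']
        · rw [lookupD_map_of_forall_ne _ (fun p hp hpx => hm ⟨p, hp, hpx⟩),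
            lookupD_filter_ne _ (by omega), ← hx']
    · have hzj : z ≠ j := by rintro rfl; omega
      have hz'' : (φ z).val / 3 = v := by
        by_cases hφ : φ z = j
        · rw [hφ, hj]
        · rwa [Perm.mul_apply, swap_apply_of_ne_of_ne hφ fun h' => hzj (hφj z h')] at hz'
      obtain ⟨p, hp, hpz⟩ := hkey z hz hz''
      exact ⟨_, List.mem_map_of_mem hp, hpz⟩
    · have := cycleCount_mul_add_one_le ψ φ hψ h
      omega

theorem turn_eq (v r y : ℕ) : turn v r y = if y / 3 = v then 3 * v + (y + r) % 3 else y := by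
  simp [turn, nat_beq_eq_decide, cond_eq_ite]

/-- The cyclic rotation of the block `v` by `r` places. -/
def blockTurn (v r : ℕ) : Perm (Fin 84) where
  toFun x := ⟨turn v r x, by rw [turn_eq]; split_ifs <;> omega⟩
  invFun x := ⟨turn v (2 * r) x, by rw [turn_eq]; split_ifs <;> omega⟩
  left_inv x := by
    ext
    simp only [turn_eq]
    split_ifs <;> omega
  right_inv x := by
    ext
    simp only [turn_eq]
    split_ifs <;> omega

theorem blockTurn_val (v r : ℕ) (x : Fin 84) : (blockTurn v r x).val = turn v r x := rfl

theorem turn_div (v r y : ℕ) : turn v r y / 3 = y / 3 := by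
  rw [turn_eq]; split_ifs <;> omega

theorem processBlock_sound (hσ : ∀ x < 84, σ (σ x) = x) {v : ℕ} (hv : v < 28) (r : ℕ)
    {s : List (ℕ × ℕ) × ℕ} {ψ φ : Perm (Fin 84)} (hψ : ∀ x : Fin 84, x.val < 3 * (v + 1) → ψ x = x)
    (hr : Represents σ (3 * v) s.1 φ) :
    ∃ φ' : Perm (Fin 84), Represents σ (3 * (v + 1)) (processBlock σ v r s).1 φ' ∧
      s.2 + cycleCount (ψ * (blockTurn v r * φ)) + 3 ≤
        (processBlock σ v r s).2 + cycleCount (ψ * φ') := by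
  obtain ⟨l, n⟩ := s
  set l₁ := addEntry σ (3 * v) (σ (3 * v + 2)) (addEntry σ (3 * v) (σ (3 * v + 1))
      (addEntry σ (3 * v) (σ (3 * v)) l)) with hl₁
  have hl : ∀ x, lookupD σ l₁ x = lookupD σ l x := fun x => by simp only [hl₁, lookupD_addEntry]
  have hk : KeysCover v (3 * v) l₁ φ := by
    intro z hz hz'
    by_contra hne
    have h₁ : ∀ p ∈ l₁, p.1 ≠ z.val := fun p hp hpz => hne ⟨p, hp, hpz⟩
    have h₂ : (φ z).val = σ z.val := by
      rw [(hr z).2 hz, ← hl, lookupD_of_forall_ne h₁]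
    have h₃ : σ (φ z).val = z.val := by rw [h₂]; exact hσ _ z.isLt
    apply hne
    have h₄ : (φ z).val = 3 * v ∨ (φ z).val = 3 * v + 1 ∨ (φ z).val = 3 * v + 2 := by omega
    rcases h₄ with h₄ | h₄ | h₄ <;> rw [h₄] at h₃ <;> rw [hl₁, h₃]
    · exact exists_mem_addEntry_of_exists
        (exists_mem_addEntry_of_exists (exists_mem_addEntry_self hz _))
    · exact exists_mem_addEntry_of_exists (exists_mem_addEntry_self hz _)
    · exact exists_mem_addEntry_self hz _
  set l₂ := l₁.map (fun p => (p.1, turn v r p.2)) with hl₂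
  have hr₂ : Represents σ (3 * v) l₂ (blockTurn v r * φ) := by
    intro x
    refine ⟨fun hx => ?_, fun hx => ?_⟩
    · rw [Perm.mul_apply, (hr x).1 hx]
      ext
      rw [blockTurn_val, turn_eq, if_neg (by omega)]
    · rw [Perm.mul_apply, blockTurn_val]
      by_cases hm : ∃ p ∈ l₁, p.1 = x.val
      · rw [hl₂, lookupD_map_of_mem _ hm, hl, (hr x).2 hx]
      · rw [hl₂, lookupD_map_of_forall_ne _ fun p hp hpx => hm ⟨p, hp, hpx⟩, hl, ← (hr x).2 hx,
          turn_eq, if_neg fun h => hm (hk x hx h)]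
  have hk₂ : KeysCover v (3 * v) l₂ (blockTurn v r * φ) := by
    intro z hz hz'
    rw [Perm.mul_apply, blockTurn_val, turn_div] at hz'
    obtain ⟨p, hp, hpz⟩ := hk z hz hz'
    exact ⟨_, List.mem_map_of_mem hp, hpz⟩
  obtain ⟨φ₁, h₁, k₁, c₁⟩ := bypass_sound (σ := σ) (j := ⟨3 * v, by omega⟩) (n := n)
    (by simp) (hψ _ (by simp)) hr₂ hk₂
  obtain ⟨φ₂, h₂, k₂, c₂⟩ := bypass_sound (σ := σ) (j := ⟨3 * v + 1, by omega⟩)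
    (n := (bypass σ (3 * v) (l₂, n)).2)
    (by simp; omega) (hψ _ (by simp; omega)) h₁ k₁
  obtain ⟨φ₃, h₃, k₃, c₃⟩ := bypass_sound (σ := σ) (j := ⟨3 * v + 2, by omega⟩)
    (n := (bypass σ (3 * v + 1) (bypass σ (3 * v) (l₂, n))).2)
    (by simp; omega) (hψ _ (by simp; omega)) h₂ k₂
  refine ⟨φ₃, h₃, ?_⟩
  have : processBlock σ v r (l, n) = bypass σ (3 * v + 2) (bypass σ (3 * v + 1)
    (bypass σ (3 * v) (l₂, n))) := rfl
  rw [this]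
  simp only [Prod.mk.eta] at c₁ c₂ c₃
  omega

theorem nearBy_sound {m : ℕ} {l l' : List (ℕ × ℕ)} (h : nearBy m l l' = true) :
    ∃ s : Finset ℕ, s.card ≤ m ∧ ∀ x ∉ s, lookupD σ l x = lookupD σ l' x := by
  induction l generalizing m l' with
  | nil =>
    cases l' with
    | nil => exact ⟨∅, by simp, fun _ _ => rfl⟩
    | cons q l' => simp [nearBy] at h
  | cons p l ih =>
    cases l' with
    | nil => simp [nearBy] at h
    | cons q l' =>
      unfold nearBy at h
      simp only [nat_beq_eq_decide, cond_eq_ite, Bool.and_eq_true, decide_eq_true_eq] at h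
      obtain ⟨hk, h⟩ : p.1 = q.1 ∧ _ := by
        by_cases hk : p.1 = q.1
        · exact ⟨hk, by simpa [hk] using h⟩
        · exfalso; simp [hk] at h
      split_ifs at h with hv
      · obtain ⟨s, hs, hx⟩ := ih h
        refine ⟨s, hs, fun x hxs => ?_⟩
        rw [lookupD_cons, lookupD_cons, hx x hxs, hk, hv]
      · cases m with
        | zero => simp at h
        | succ m =>
          obtain ⟨s, hs, hx⟩ := ih h
          refine ⟨insert p.1 s, (Finset.card_insert_le _ _).trans (by omega), fun x hxs => ?_⟩
          rw [Finset.mem_insert, not_or] at hxs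
          rw [lookupD_cons, lookupD_cons, hx x hxs.2, ← hk, if_neg (Ne.symm hxs.1),
            if_neg (Ne.symm hxs.1)]

/-- `ψ` fixes the blocks before `v`, and turns the others cyclically. -/
def TurnsFrom (v : ℕ) (ψ : Perm (Fin 84)) : Prop :=
  (∀ x : Fin 84, x.val < 3 * v → ψ x = x) ∧
    ∀ w, v ≤ w → ∃ r, (r = 1 ∨ r = 2) ∧ ∀ x : Fin 84, x.val / 3 = w → (ψ x).val = turn w r x

/-- The search bound for the state `s`, when the `k` blocks from `v` on are left. -/
def StateBound (σ : ℕ → ℕ) (B k v : ℕ) (s : List (ℕ × ℕ) × ℕ) : Prop :=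
  ∀ ψ φ : Perm (Fin 84), TurnsFrom v ψ → Represents σ (3 * v) s.1 φ →
    s.2 + cycleCount (ψ * φ) + 3 * k ≤ B + 84

theorem TurnsFrom.exists_eq_mul {v : ℕ} {ψ : Perm (Fin 84)} (h : TurnsFrom v ψ) :
    ∃ r, (r = 1 ∨ r = 2) ∧ ∃ ψ', TurnsFrom (v + 1) ψ' ∧ ψ = ψ' * blockTurn v r := by
  obtain ⟨r, hr, hx⟩ := h.2 v le_rfl
  have hin : ∀ x : Fin 84, x.val / 3 = v → (ψ * (blockTurn v r)⁻¹) x = x := by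
    intro x hxv
    have h₁ : ((blockTurn v r)⁻¹ x).val / 3 = v := by
      have h₂ : blockTurn v r ((blockTurn v r)⁻¹ x) = x := by
        rw [← Perm.mul_apply, mul_inv_cancel, Perm.one_apply]
      rw [← turn_div v r, ← blockTurn_val, h₂, hxv]
    ext
    rw [Perm.mul_apply, hx _ h₁, ← blockTurn_val, ← Perm.mul_apply, mul_inv_cancel,
      Perm.one_apply]
  have hout : ∀ x : Fin 84, x.val / 3 ≠ v → (ψ * (blockTurn v r)⁻¹) x = ψ x := by
    intro x hxv
    have h₁ : blockTurn v r x = x := by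
      ext
      rw [blockTurn_val, turn_eq, if_neg hxv]
    rw [Perm.mul_apply]
    congr 1
    rw [Perm.inv_eq_iff_eq, h₁]
  refine ⟨r, hr, ψ * (blockTurn v r)⁻¹, ⟨fun x hxv => ?_, fun w hw => ?_⟩, by group⟩
  · by_cases h₁ : x.val / 3 = v
    · exact hin x h₁
    · rw [hout x h₁]
      exact h.1 x (by omega)
  · obtain ⟨r', hr', hx'⟩ := h.2 w (by omega)
    exact ⟨r', hr', fun x hxw => by rw [hout x (by omega), hx' x hxw]⟩

theorem StateBound.of_dominates {B k v : ℕ} {s t : List (ℕ × ℕ) × ℕ}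
    (hs : ∃ φ, Represents σ (3 * v) s.1 φ) (h : StateBound σ B k v s)
    (hd : dominates s t = true) : StateBound σ B k v t := by
  obtain ⟨φs, hφs⟩ := hs
  intro ψ φ hψ hφ
  have hb := h ψ φs hψ hφs
  have agree : ∀ m, nearBy m s.1 t.1 = true →
      ∃ A : Finset (Fin 84), A.card ≤ m ∧ ∀ x ∉ A, φ x = φs x := by
    intro m hm
    obtain ⟨A, hA, hx⟩ := nearBy_sound (σ := σ) hm
    refine ⟨Finset.univ.filter fun x => x.val ∈ A, ?_, fun x hxA => ?_⟩
    · refine le_trans ?_ hA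
      exact Finset.card_le_card_of_injOn Fin.val (by intro x hx; simpa using hx)
        Fin.val_injective.injOn
    · have hxA' : x.val ∉ A := by simpa using hxA
      rcases Nat.lt_or_ge x.val (3 * v) with hlt | hge
      · rw [(hφ x).1 hlt, (hφs x).1 hlt]
      · ext
        rw [(hφ x).2 hge, (hφs x).2 hge, hx _ hxA']
  simp only [dominates, cond_eq_ite, Nat.ble_eq, nat_beq_eq_decide, decide_eq_true_eq] at hd
  split_ifs at hd with h₁ h₂
  · obtain ⟨A, hA, hx⟩ := agree 0 hd
    have : φ = φs := by
      ext x
      rw [hx x (by simp [Finset.card_eq_zero.1 (Nat.le_zero.1 hA)])]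
    rw [this]; omega
  · obtain ⟨A, hA, hx⟩ := agree 2 hd
    have := cycleCount_mul_le_of_agree ψ φ φs A hA hx
    omega

theorem prune_subset (B : ℕ) (L : List (List (ℕ × ℕ) × ℕ)) : ∀ s ∈ prune B L, s ∈ L := by
  have one : ∀ (t : List (ℕ × ℕ) × ℕ) (K : List (List (ℕ × ℕ) × ℕ)), t ∈ L → (∀ s ∈ K, s ∈ L) →
      ∀ s ∈ (bif K.any (fun s => dominates s t) then K else t :: K), s ∈ L := by
    intro t K ht hK s hs
    rw [cond_eq_ite] at hs
    split_ifs at hs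
    · exact hK s hs
    · rcases List.mem_cons.1 hs with rfl | hs
      · exact ht
      · exact hK s hs
  have inner : ∀ (M K : List (List (ℕ × ℕ) × ℕ)), (∀ s ∈ M, s ∈ L) → (∀ s ∈ K, s ∈ L) →
      ∀ s ∈ M.foldr (fun t K => bif K.any (fun s => dominates s t) then K else t :: K) K,
        s ∈ L := by
    intro M K hM hK
    induction M with
    | nil => exact hK
    | cons t M ih =>
      exact one t _ (hM t (by simp)) (ih fun s hs => hM s (by simp [hs]))
  unfold prune
  induction List.range (B + 1) with
  | nil => intro s hs; exact (List.mem_filter.1 hs).1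
  | cons c R ih => exact inner _ _ (fun s hs => (List.mem_filter.1 hs).1) ih

theorem exists_mem_prune (B : ℕ) (L : List (List (ℕ × ℕ) × ℕ)) {t : List (ℕ × ℕ) × ℕ}
    (ht : t ∈ L) : ∃ s ∈ prune B L, s = t ∨ dominates s t = true := by
  set step : List (ℕ × ℕ) × ℕ → List (List (ℕ × ℕ) × ℕ) → List (List (ℕ × ℕ) × ℕ) :=
    fun t K => bif K.any (fun s => dominates s t) then K else t :: K with hstep
  have mono₁ : ∀ u K, ∀ s ∈ K, s ∈ step u K := by
    intro u K s hs
    simp only [hstep, cond_eq_ite]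
    split_ifs <;> simp [hs]
  have mono : ∀ (M K : List (List (ℕ × ℕ) × ℕ)), ∀ s ∈ K, s ∈ M.foldr step K := by
    intro M K s hs
    induction M with
    | nil => exact hs
    | cons u M ih => exact mono₁ u _ s ih
  have new₁ : ∀ u K, ∃ s ∈ step u K, s = u ∨ dominates s u = true := by
    intro u K
    simp only [hstep, cond_eq_ite]
    split_ifs with h
    · obtain ⟨s, hs, hd⟩ := List.any_eq_true.1 h
      exact ⟨s, hs, Or.inr hd⟩
    · exact ⟨u, by simp, Or.inl rfl⟩
  have new : ∀ (M K : List (List (ℕ × ℕ) × ℕ)), t ∈ M →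
      ∃ s ∈ M.foldr step K, s = t ∨ dominates s t = true := by
    intro M K htM
    induction M with
    | nil => simp at htM
    | cons u M ih =>
      rcases List.mem_cons.1 htM with rfl | htM
      · exact new₁ _ _
      · obtain ⟨s, hs, h⟩ := ih htM
        exact ⟨s, mono₁ _ _ s hs, h⟩
  have outer : ∀ (R : List ℕ) (K : List (List (ℕ × ℕ) × ℕ)), (t.2 ∈ R ∨ t ∈ K) →
      ∃ s ∈ R.foldr (fun c K => (L.filter fun t => Nat.beq t.2 c).foldr step K) K,
        s = t ∨ dominates s t = true := by
    intro R K h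
    induction R with
    | nil => exact ⟨t, by simpa using h, Or.inl rfl⟩
    | cons c R ih =>
      by_cases hc : t.2 = c
      · exact new _ _ (List.mem_filter.2 ⟨ht, by simp [hc]⟩)
      · obtain ⟨s, hs, h'⟩ := ih (h.imp_left fun h => (List.mem_cons.1 h).resolve_left hc)
        exact ⟨s, mono _ _ s hs, h'⟩
  refine outer (List.range (B + 1)) _ ?_
  by_cases hB : t.2 ≤ B
  · exact Or.inl (List.mem_range.2 (by omega))
  · refine Or.inr (List.mem_filter.2 ⟨ht, ?_⟩)
    simp [Nat.blt]; omega

theorem searchBound_sound (hσ : ∀ x < 84, σ (σ x) = x) {B k v : ℕ} (hv : v + k = 28)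
    {L : List (List (ℕ × ℕ) × ℕ)} (hL : ∀ s ∈ L, ∃ φ, Represents σ (3 * v) s.1 φ)
    (h : searchBound σ B k v L = true) : ∀ s ∈ L, StateBound σ B k v s := by
  induction k generalizing v L with
  | zero =>
    intro s hs ψ φ _ _
    have h₁ : s.2 ≤ B := by
      have := List.all_eq_true.1 h s hs
      simpa using this
    have h₂ := cycleCount_le_card (ψ * φ)
    rw [Nat.card_eq_fintype_card, Fintype.card_fin] at h₂
    omega
  | succ k ih =>
    rw [searchBound, withStates_eq, withStates_eq] at h
    set L' := L.flatMap fun s => [processBlock σ v 1 s, processBlock σ v 2 s] with hL'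
    have hrep : ∀ s ∈ L', ∃ φ, Represents σ (3 * (v + 1)) s.1 φ := by
      intro s hs
      obtain ⟨t, ht, hst⟩ := List.mem_flatMap.1 hs
      obtain ⟨φ, hφ⟩ := hL t ht
      have := fun r => processBlock_sound hσ (v := v) (by omega) r (s := t) (ψ := 1) (φ := φ)
        (fun x _ => rfl) hφ
      rcases List.mem_pair.1 hst with rfl | rfl
      · obtain ⟨φ', h', -⟩ := this 1
        exact ⟨φ', h'⟩
      · obtain ⟨φ', h', -⟩ := this 2
        exact ⟨φ', h'⟩
    have hsub := prune_subset B L'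
    have hpr := ih (v := v + 1) (by omega) (fun s hs => hrep s (hsub s hs)) h
    have hall : ∀ s ∈ L', StateBound σ B k (v + 1) s := by
      intro t ht
      obtain ⟨s, hs, rfl | hd⟩ := exists_mem_prune B L' ht
      · exact hpr _ hs
      · exact (hpr s hs).of_dominates (hrep s (hsub s hs)) hd
    intro s hs ψ φ hψ hφ
    obtain ⟨r, hr, ψ', hψ', rfl⟩ := hψ.exists_eq_mul
    obtain ⟨φ', hφ', hc⟩ := processBlock_sound hσ (v := v) (by omega) r (s := s) hψ'.1 hφ
    have hmem : processBlock σ v r s ∈ L' :=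
      List.mem_flatMap.2 ⟨s, hs, by rcases hr with rfl | rfl <;> simp⟩
    have := hall _ hmem ψ' φ' hψ' hφ'
    rw [mul_assoc]
    omega

theorem cycleCount_le_of_searchBound (hσ : ∀ x < 84, σ (σ x) = x) {B : ℕ}
    (h : searchBound σ B 28 0 [([], 0)] = true) {ψ φ : Perm (Fin 84)} (hψ : TurnsFrom 0 ψ)
    (hφ : ∀ x, (φ x).val = σ x) : cycleCount (ψ * φ) ≤ B := by
  have hr : Represents σ (3 * 0) [] φ := fun x => ⟨fun hx => by omega, fun _ => hφ x⟩
  have := searchBound_sound hσ (by norm_num) (L := [([], 0)])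
    (fun s hs => ⟨φ, by rw [List.mem_singleton.1 hs]; exact hr⟩) h ([], 0) (by simp) ψ φ hψ hr
  simp only at this
  omega

end FaceSearch

/-- The 28 vertices of `M4`: eight for each triple, followed by `d₀, d₁, d₂, d₃`. -/
def vertexOf (n : ℕ) : ScaffoldVertex (Fin 13) 3 :=
  if n < 24 then
    let i := Fin.ofNat 3 (n / 8)
    match n % 8 with
    | 0 => .inr (i, .inl 0)
    | 1 => .inr (i, .inl 1)
    | 2 => .inr (i, .inr 0)
    | 3 => .inr (i, .inr 1)
    | 4 => .inr (i, .inr 2)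
    | 5 => .inl (T3 i 0)
    | 6 => .inl (T3 i 1)
    | _ => .inl (T3 i 2)
  else
    match n with
    | 24 => .inl 0
    | 25 => .inl 4
    | 26 => .inl 5
    | _ => .inl 9

/-- Darts of `M4` are numbered so that the darts at vertex `n` are `3 * n`, `3 * n + 1` and
`3 * n + 2`; this is the number of the reversed dart. -/
def reverseDart (x : ℕ) : ℕ :=
  ([6, 9, 12, 7, 10, 13, 0, 3, 15, 1, 4, 18, 2, 5, 21, 8, 39, 72, 11, 42, 78, 14, 45, 81, 30,
    33, 36, 31, 34, 37, 24, 27, 40, 25, 28, 43, 26, 29, 46, 16, 32, 63, 19, 35, 66, 22, 38, 69,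
    54, 57, 60, 55, 58, 61, 48, 51, 64, 49, 52, 67, 50, 53, 70, 41, 56, 75, 44, 59, 82, 47, 62,
    73, 17, 71, 79, 65, 80, 83, 20, 74, 76, 23, 68, 77] : List ℕ).getD x 0

theorem reverseDart_reverseDart : ∀ x < 84, reverseDart (reverseDart x) = x := by
  decide +kernel

theorem reverseDart_lt : ∀ x < 84, reverseDart x < 84 := by
  decide +kernel

theorem vertexOf_injOn : ∀ m < 28, ∀ n < 28, vertexOf m = vertexOf n → m = n := by
  decide +kernel

theorem dart_eq_of_heads : ∀ x < 84, ∀ y < 84, x / 3 = y / 3 →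
    reverseDart x / 3 = reverseDart y / 3 → x = y := by
  decide +kernel

theorem adj_vertexOf : ∀ x < 84, M4.Adj (vertexOf (x / 3)) (vertexOf (reverseDart x / 3)) := by
  decide +kernel

theorem degree_M4 : ∀ v, M4.degree v = 3 := by
  decide +kernel

theorem card_vertices_M4 : Fintype.card (ScaffoldVertex (Fin 13) 3) = 28 := by
  decide +kernel

theorem card_dart_M4 : Fintype.card M4.Dart = 84 := by
  rw [SimpleGraph.dart_card_eq_sum_degrees]
  simp only [degree_M4, Finset.sum_const, Finset.card_univ, card_vertices_M4]
  rfl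

theorem card_edgeSet_M4 : Nat.card M4.edgeSet = 42 := by
  have h := M4.dart_card_eq_twice_card_edges
  rw [card_dart_M4] at h
  rw [Nat.card_eq_fintype_card, ← SimpleGraph.edgeFinset_card]
  omega

def dartOf (x : Fin 84) : M4.Dart :=
  ⟨(vertexOf (x.val / 3), vertexOf (reverseDart x.val / 3)), adj_vertexOf x.val x.isLt⟩

theorem dartOf_bijective : Function.Bijective dartOf := by
  rw [Fintype.bijective_iff_injective_and_card, card_dart_M4, Fintype.card_fin]
  refine ⟨fun x y h => ?_, rfl⟩
  have h₁ : vertexOf (x.val / 3) = vertexOf (y.val / 3) := congrArg (fun d => d.fst) h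
  have h₂ : vertexOf (reverseDart x.val / 3) = vertexOf (reverseDart y.val / 3) :=
    congrArg (fun d => d.snd) h
  have hx := reverseDart_lt x.val x.isLt
  have hy := reverseDart_lt y.val y.isLt
  exact Fin.ext (dart_eq_of_heads _ x.isLt _ y.isLt (vertexOf_injOn _ (by omega) _ (by omega) h₁)
    (vertexOf_injOn _ (by omega) _ (by omega) h₂))

noncomputable def dartEquiv : Fin 84 ≃ M4.Dart := Equiv.ofBijective dartOf dartOf_bijective

theorem dartEquiv_fst (x : Fin 84) : (dartEquiv x).fst = vertexOf (x.val / 3) := rfl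

theorem dartEquiv_fst_eq_iff (x y : Fin 84) :
    (dartEquiv x).fst = (dartEquiv y).fst ↔ x.val / 3 = y.val / 3 := by
  rw [dartEquiv_fst, dartEquiv_fst]
  exact ⟨fun h => vertexOf_injOn _ (by omega) _ (by omega) h, fun h => by rw [h]⟩

/-- Reversal of darts, as a permutation of their numbers. -/
def reversePerm : Perm (Fin 84) where
  toFun x := ⟨reverseDart x, reverseDart_lt x x.isLt⟩
  invFun x := ⟨reverseDart x, reverseDart_lt x x.isLt⟩
  left_inv x := Fin.ext (reverseDart_reverseDart x x.isLt)
  right_inv x := Fin.ext (reverseDart_reverseDart x x.isLt)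

theorem dartEquiv_reversePerm (x : Fin 84) : dartEquiv (reversePerm x) = (dartEquiv x).symm := by
  refine SimpleGraph.Dart.ext _ _ (Prod.ext rfl ?_)
  change vertexOf (reverseDart (reverseDart x) / 3) = vertexOf (x / 3)
  rw [reverseDart_reverseDart x x.isLt]

theorem faceNext_eq_permCongr (R : RotationSystem M4) :
    R.faceNext = dartEquiv.permCongr (dartEquiv.symm.permCongr R.next * reversePerm) := by
  ext1 d
  obtain ⟨x, rfl⟩ := dartEquiv.surjective d
  rw [permCongr_apply, symm_apply_apply, Perm.mul_apply, permCongr_apply, apply_symm_apply,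
    symm_symm, dartEquiv_reversePerm]
  rfl

theorem numFaces_M4 (R : RotationSystem M4) :
    R.numFaces = cycleCount (dartEquiv.symm.permCongr R.next * reversePerm) := by
  have h : IsEmpty {v // ∀ w, ¬ M4.Adj v w} := by
    refine ⟨fun v => ?_⟩
    have h₁ : 0 < M4.degree v.1 := by rw [degree_M4]; norm_num
    obtain ⟨w, hw⟩ := (M4.degree_pos_iff_exists_adj v.1).1 h₁
    exact v.2 w hw
  rw [RotationSystem.numFaces, @Nat.card_of_isEmpty _ h, add_zero, faceNext_eq_permCongr]
  exact cycleCount_permCongr _ _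

/-- A permutation of the darts that permutes the three darts at each vertex without fixed points
turns them cyclically. -/
theorem turnsFrom_zero {ψ : Perm (Fin 84)} (hb : ∀ x, (ψ x).val / 3 = x.val / 3)
    (hne : ∀ x, ψ x ≠ x) : TurnsFrom 0 ψ := by
  refine ⟨fun x hx => by omega, fun w _ => ?_⟩
  by_cases hw : w < 28
  · obtain ⟨a, ha⟩ : ∃ a : Fin 84, a.val = 3 * w := ⟨⟨3 * w, by omega⟩, rfl⟩
    obtain ⟨b, hab⟩ : ∃ b : Fin 84, b.val = 3 * w + 1 := ⟨⟨3 * w + 1, by omega⟩, rfl⟩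
    obtain ⟨c, hac⟩ : ∃ c : Fin 84, c.val = 3 * w + 2 := ⟨⟨3 * w + 2, by omega⟩, rfl⟩
    have inj : ∀ x y : Fin 84, x.val ≠ y.val → (ψ x).val ≠ (ψ y).val := fun x y h h' =>
      h (congrArg Fin.val (ψ.injective (Fin.ext h')))
    have h₀ := hb a
    have h₁ := hb b
    have h₂ := hb c
    have n₀ := Fin.val_ne_of_ne (hne a)
    have n₁ := Fin.val_ne_of_ne (hne b)
    have n₂ := Fin.val_ne_of_ne (hne c)
    have m₀ := inj a b (by omega)
    have m₁ := inj a c (by omega)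
    have m₂ := inj b c (by omega)
    have cases3 : ∀ x : Fin 84, x.val / 3 = w → x = a ∨ x = b ∨ x = c := by
      intro x hx
      simp only [Fin.ext_iff]
      omega
    have hr : ∃ r, (r = 1 ∨ r = 2) ∧ (ψ a).val = 3 * w + r % 3 ∧
        (ψ b).val = 3 * w + (1 + r) % 3 ∧ (ψ c).val = 3 * w + (2 + r) % 3 := by
      generalize (ψ a).val = p at *
      generalize (ψ b).val = q at *
      generalize (ψ c).val = s at *
      rw [ha] at h₀ n₀
      rw [hab] at h₁ n₁
      rw [hac] at h₂ n₂
      by_cases hp : p = 3 * w + 1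
      · exact ⟨1, by omega⟩
      · exact ⟨2, by omega⟩
    obtain ⟨r, hr, ra, rb, rc⟩ := hr
    refine ⟨r, hr, fun x hx => ?_⟩
    rw [turn_eq, if_pos hx]
    rcases cases3 x hx with rfl | rfl | rfl
    · rw [ra]; omega
    · rw [rb]; omega
    · rw [rc]; omega
  · exact ⟨1, Or.inl rfl, fun x hx => by omega⟩

theorem turnsFrom_rotationSystem (R : RotationSystem M4) :
    TurnsFrom 0 (dartEquiv.symm.permCongr R.next) := by
  have happ : ∀ x, dartEquiv (dartEquiv.symm.permCongr R.next x) = R.next (dartEquiv x) := by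
    intro x
    rw [permCongr_apply, apply_symm_apply, symm_symm]
  refine turnsFrom_zero (fun x => ?_) (fun x hx => ?_)
  · rw [← dartEquiv_fst_eq_iff, happ, R.fst_next]
  · have hfix : R.next (dartEquiv x) = dartEquiv x := by rw [← happ, hx]
    obtain ⟨y, hy, hyx⟩ : ∃ y : Fin 84, y.val / 3 = x.val / 3 ∧ y ≠ x := by
      refine ⟨blockTurn (x / 3) 1 x, ?_, fun h => ?_⟩
      · rw [blockTurn_val, turn_div]
      · have := congrArg Fin.val h
        rw [blockTurn_val, turn_eq, if_pos rfl] at this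
        omega
    have hs := R.cyclic (dartEquiv x) (dartEquiv y) ((dartEquiv_fst_eq_iff _ _).2 hy.symm)
    exact hyx (dartEquiv.injective (hs.eq_of_left hfix)).symm

theorem searchBound_M4 : searchBound reverseDart 8 28 0 [([], 0)] = true := by
  decide +kernel

theorem numFaces_M4_le (R : RotationSystem M4) : R.numFaces ≤ 8 := by
  rw [numFaces_M4]
  exact cycleCount_le_of_searchBound reverseDart_reverseDart searchBound_M4
    (turnsFrom_rotationSystem R) fun _ => rfl

/-- The turn at each vertex, in a rotation system of `M4` with eight faces. -/
def genusFourTurn (v : ℕ) : ℕ :=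
  ([2, 1, 1, 2, 2, 1, 1, 2, 2, 1, 1, 2, 2, 1, 1, 2, 1, 2, 2, 2, 1, 1, 1, 2, 2, 2, 1, 2] : List ℕ).getD v 0

/-- The face to the dart `x`, in the rotation system `genusFourTurn`. -/
def genusFourFace (x : ℕ) : ℕ :=
  ([0, 1, 1, 2, 0, 1, 1, 0, 2, 0, 1, 1, 1, 2, 1, 1, 2, 3, 1, 1, 4, 2, 1, 1, 5, 1, 2, 6, 5, 1, 2,
    5, 6, 5, 1, 1, 1, 6, 2, 3, 2, 6, 4, 1, 1, 2, 6, 1, 4, 1, 7, 1, 7, 6, 1, 6, 4, 7, 1, 1, 4, 7,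
    6, 3, 6, 4, 4, 1, 1, 6, 4, 1, 1, 4, 3, 3, 1, 4, 1, 4, 3, 1, 4, 1] : List ℕ).getD x 0

def genusFourNext : Perm (Fin 84) where
  toFun x := ⟨turn (x / 3) (genusFourTurn (x / 3)) x, by rw [turn_eq]; split_ifs <;> omega⟩
  invFun x := ⟨turn (x / 3) (2 * genusFourTurn (x / 3)) x, by rw [turn_eq]; split_ifs <;> omega⟩
  left_inv x := by
    ext
    dsimp only
    rw [turn_div, turn_eq, turn_eq]
    split_ifs <;> omega
  right_inv x := by
    ext
    dsimp only
    rw [turn_div, turn_eq, turn_eq]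
    split_ifs <;> omega

theorem genusFourNext_orbit : ∀ x y : Fin 84, x.val / 3 = y.val / 3 →
    x = y ∨ genusFourNext x = y ∨ genusFourNext (genusFourNext x) = y := by
  decide +kernel

theorem genusFourFace_invariant : ∀ x : Fin 84,
    genusFourFace x = genusFourFace (genusFourNext (reversePerm x)) := by
  decide +kernel

theorem genusFourFace_surjective : ∀ i < 8, ∃ x : Fin 84, genusFourFace x = i := by
  decide +kernel

theorem genusFourFace_lt : ∀ x : Fin 84, genusFourFace x < 8 := by
  decide +kernel

noncomputable def genusFourRotation : RotationSystem M4 where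
  next := dartEquiv.permCongr genusFourNext
  fst_next d := by
    obtain ⟨x, rfl⟩ := dartEquiv.surjective d
    rw [permCongr_apply, symm_apply_apply, dartEquiv_fst_eq_iff]
    exact turn_div _ _ _
  cyclic d d' h := by
    obtain ⟨x, rfl⟩ := dartEquiv.surjective d
    obtain ⟨y, rfl⟩ := dartEquiv.surjective d'
    rw [dartEquiv_fst_eq_iff] at h
    rcases genusFourNext_orbit x y h with h | h | h
    · exact ⟨0, by simp [h]⟩
    · exact ⟨1, by simp [h]⟩
    · exact ⟨2, by simp [zpow_ofNat, pow_two, h]⟩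

theorem numFaces_genusFourRotation : genusFourRotation.numFaces = 8 := by
  refine le_antisymm (numFaces_M4_le _) ?_
  have hnext : dartEquiv.symm.permCongr genusFourRotation.next = genusFourNext := by
    ext x
    simp [genusFourRotation]
  rw [numFaces_M4, hnext]
  let f : Quotient (SameCycle.setoid (genusFourNext * reversePerm)) → Fin 8 :=
    Quotient.lift (fun x => ⟨genusFourFace x, genusFourFace_lt x⟩) fun x y h =>
      SameCycle.rel_of_forall
        (Setoid.ker fun x : Fin 84 => (⟨genusFourFace x, genusFourFace_lt x⟩ : Fin 8))
        (fun x => Fin.ext (genusFourFace_invariant x)) h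
  have hf : Function.Surjective f := by
    intro i
    obtain ⟨x, hx⟩ := genusFourFace_surjective i i.isLt
    exact ⟨Quotient.mk _ x, Fin.ext hx⟩
  have h := Nat.card_le_card_of_surjective f hf
  rwa [Nat.card_eq_fintype_card, Fintype.card_fin] at h

/-- The distance of the vertex `n` from the vertex `0`. -/
def rootDist (n : ℕ) : ℕ :=
  ([0, 2, 1, 1, 1, 2, 2, 2, 5, 5, 4, 4, 4, 3, 3, 3, 6, 6, 5, 5, 5, 4, 4, 4, 3, 4, 3, 3] :
    List ℕ).getD n 0

theorem exists_rootDist_lt : ∀ n : Fin 28, n = 0 ∨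
    ∃ x : Fin 84, x.val / 3 = n.val ∧ rootDist (reverseDart x / 3) < rootDist n := by
  decide +kernel

theorem exists_vertexOf_eq : ∀ v, ∃ n < 28, vertexOf n = v := by
  decide +kernel

theorem connected_M4 : M4.Connected := by
  have h : ∀ d n, rootDist n = d → n < 28 → M4.Reachable (vertexOf 0) (vertexOf n) := by
    intro d
    induction d using Nat.strong_induction_on with
    | _ d ih =>
      intro n hd hn
      obtain h | ⟨x, hx, h⟩ := exists_rootDist_lt ⟨n, hn⟩
      · rw [show n = 0 from congrArg Fin.val h]
      · have hxn := (adj_vertexOf x x.isLt).symm.reachable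
        rw [hx] at hxn
        have := reverseDart_lt x x.isLt
        exact (ih _ (hd ▸ h) _ rfl (by omega)).trans hxn
  rw [SimpleGraph.connected_iff_exists_forall_reachable]
  refine ⟨vertexOf 0, fun v => ?_⟩
  obtain ⟨n, hn, rfl⟩ := exists_vertexOf_eq v
  exact h _ n rfl hn

theorem bettiNumber_M4 : bettiNumber M4 = 15 := by
  have : Nat.card M4.ConnectedComponent = 1 := by
    rw [Nat.card_eq_one_iff_unique]
    exact ⟨connected_M4.preconnected.subsingleton_connectedComponent,
      ⟨M4.connectedComponentMk (.inl 0)⟩⟩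
  rw [bettiNumber, card_edgeSet_M4, this, Nat.card_eq_fintype_card, card_vertices_M4]
  norm_num

theorem hasGenus_M4 : HasGenus M4 4 := by
  constructor
  · refine ⟨connected_M4, genusFourRotation, ?_⟩
    rw [numFaces_genusFourRotation, card_edgeSet_M4, Nat.card_eq_fintype_card, card_vertices_M4]
    norm_num
  · rintro j ⟨-, R, hR⟩
    have h := numFaces_M4_le R
    rw [card_edgeSet_M4, Nat.card_eq_fintype_card, card_vertices_M4] at hR
    omega

end Milgram

theorem mainTheorem10 :
    Fintype.card (Milgram.ScaffoldVertex (Fin 13) 3) = 28 ∧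
      (∀ v, Milgram.M4.degree v = 3) ∧
      Milgram.bettiNumber Milgram.M4 = 15 ∧
      Milgram.HasGenus Milgram.M4 4 :=
  ⟨Milgram.card_vertices_M4, Milgram.degree_M4, Milgram.bettiNumber_M4, Milgram.hasGenus_M4⟩
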